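/- In the $\mathsf{u^TMv}$ query model an algorithm accesses an unknown matrix $M\in\mathbb{C}^{n\times n}$ only by choosing pairs of vectors $u,v\in\mathbb{C}^n$ and receiving the exact value of $u^{\mathrm T}Mv$. Queries may be adaptive and randomized: a randomized algorithm uses an internal random source (an arbitrary probability space), and for each outcome of it is a deterministic adaptive algorithm that ends with a yes/no answer. It *decides unitarity on a class $\mathcal{S}$ of matrices with probability $p$* if for every $M\in\mathcal{S}$ its answer to "is $M$ unitary?" is correct with probability at least $p$. A family of complex numbers has *precision $B$* if its members can be written as $(a+b\,\mathrm{i})/d$ with one common integer denominator $1\le d\le B$ and integers $|a|,|b|\le B$. Entries of precision $n^{O(1)}$ are the entries of $O(\log n)$ bit-complexity. **Theorem.** Fix a success probability $p\in(1/2,1)$ and integers $b,c\ge 1$. 1. (Lower bound $\Omega(n/\log n)$.) There is a constant $K>0$, depending only on $p,b,c$, such that for every $n\ge 2$: any randomized adaptive algorithm that decides unitarity with probability $p$ on the class of all $n\times n$ complex matrices whose family of entries has precision $n^{b}$, using on these matrices only query vectors of precision $n^{c}$, and at most $q$ queries, satisfies $q\ge K\,n/\log n$. 2. (Upper bound $O(n)$.)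 There is a constant $C$, depending only on $p$ and $c$, such that for every $n\ge 1$ there is a randomized algorithm that decides unitarity with probability $p$ on the class of all $n\times n$ complex matrices, using only query vectors of precision $n^{c}$, and at most $Cn$ queries. -/

import Mathlib

/-- A deterministic adaptive algorithm in the vector-matrix-vector query model for `n × n` complex
matrices: either stop with a yes/no answer, or query a pair `(u, v)` and continue in a way that
depends on the value of `uᵀ M v`. -/
inductive QueryTree (n : ℕ) : Type
  | answer (b : Bool) : QueryTree n
  | query (u v : Fin n → ℂ) (next : ℂ → QueryTree n) : QueryTree n

namespace QueryTree

variable {n : ℕ}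

/-- The answer of the algorithm on the matrix `M`. -/
def output (M : Matrix (Fin n) (Fin n) ℂ) : QueryTree n → Bool
  | answer b => b
  | query u v next => (next (u ⬝ᵥ M.mulVec v)).output M

/-- The list of all queries that the algorithm makes on the matrix `M`. -/
def queries (M : Matrix (Fin n) (Fin n) ℂ) :
    QueryTree n → List ((Fin n → ℂ) × (Fin n → ℂ))
  | answer _ => []
  | query u v next => (u, v) :: (next (u ⬝ᵥ M.mulVec v)).queries M

end QueryTree

/-- A randomized adaptive query algorithm: a deterministic one for each outcome of the internal
randomness, which is modelled by an arbitrary probability space. -/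
structure RandomizedQueryAlgorithm (n : ℕ) where
  Ω : Type
  mΩ : MeasurableSpace Ω
  μ : MeasureTheory.Measure Ω
  isProb : MeasureTheory.IsProbabilityMeasure μ
  tree : Ω → QueryTree n

attribute [instance] RandomizedQueryAlgorithm.mΩ RandomizedQueryAlgorithm.isProb

/-- Fixed-point precision `B` for a family of complex numbers: the entries have the form
`(a + b i) / d` with one common denominator `1 ≤ d ≤ B` and integers `|a|, |b| ≤ B`.
For `B = n ^ c` every entry takes `O(log n)` bits. -/
def HasPrecision {ι : Type*} (B : ℕ) (x : ι → ℂ) : Prop :=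
  ∃ d : ℕ, 1 ≤ d ∧ d ≤ B ∧
    ∀ i, ∃ a b : ℤ, |a| ≤ B ∧ |b| ≤ B ∧ x i = ((a : ℂ) + (b : ℂ) * Complex.I) / (d : ℂ)

/-- The `n × n` complex matrices all of whose entries have fixed-point precision `B`. -/
def preciseMatrices (n B : ℕ) : Set (Matrix (Fin n) (Fin n) ℂ) :=
  {M | HasPrecision B fun ij : Fin n × Fin n => M ij.1 ij.2}

namespace RandomizedQueryAlgorithm

variable {n : ℕ}

/-- On every matrix in `S`, the algorithm always makes at most `q` queries. -/
def MakesAtMost (A : RandomizedQueryAlgorithm n) (S : Set (Matrix (Fin n) (Fin n) ℂ))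
    (q : ℕ) : Prop :=
  ∀ M ∈ S, ∀ ω, ((A.tree ω).queries M).length ≤ q

/-- On every matrix in `S`, the algorithm only makes queries `(u, v)` in which both vectors have
fixed-point precision `B`. -/
def QueriesHavePrecision (A : RandomizedQueryAlgorithm n)
    (S : Set (Matrix (Fin n) (Fin n) ℂ)) (B : ℕ) : Prop :=
  ∀ M ∈ S, ∀ ω, ∀ w ∈ (A.tree ω).queries M, HasPrecision B w.1 ∧ HasPrecision B w.2

/-- On every matrix in `S`, the algorithm answers correctly, with probability at least `p`, whether
the matrix is unitary. -/
def DecidesUnitary (A : RandomizedQueryAlgorithm n) (S : Set (Matrix (Fin n) (Fin n) ℂ))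
    (p : ℝ) : Prop :=
  ∀ M ∈ S, MeasurableSet {ω | (A.tree ω).output M = true} ∧
    p ≤ A.μ.real {ω | (A.tree ω).output M = true ↔ M ∈ Matrix.unitaryGroup (Fin n) ℂ}

end RandomizedQueryAlgorithm

/-! Upper bound: a Freivalds-type test. `M` is unitary iff `H = Mᴴ * M - 1` vanishes. If `H ≠ 0`,
random `0/1`-vectors `v`, `w` give `wᵀ H v ≠ 0` with probability at least `1/4`. This form is
computed from `M v` and `M w`, which cost `2n` queries against unit vectors. A constant number of
rounds suffices (`exists_randomized_unitarity_test`).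

Lower bound: a reduction from set disjointness. `disjointnessMatrix x y` is the sum of a diagonal
matrix depending on `x` and one depending on `y`, and is unitary iff `x` and `y` are disjoint. Each
query value is the sum of two parts, one per player, each with polynomially many possible values. So
`q` queries give a protocol with at most `n ^ O(q)` transcripts, whose classes are rectangles.

Such a partition `S` cannot detect disjointness unless `log |S|` is of order `n`
(`sq_sum_disjointness_le`). Mask `x` by a random set `D` and `y` by its complement, and pin both
bits at a random `i` to `e`. The level-one inequality and an entropy bound show that the transcript
depends little, in Hellinger distance, on one player's bit at a typical `i`; cut-and-paste
(`sq_sum_sub_le_of_product`) extends this to changing both bits. -/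

open Matrix

/-! ### Upper bound: nonadaptive queries and the randomized unitarity test -/

namespace QueryTree

variable {n : ℕ}

/-- The nonadaptive algorithm that makes the queries of a list and decides by their values. -/
def ofList : List ((Fin n → ℂ) × (Fin n → ℂ)) → (List ℂ → Bool) → QueryTree n
  | [], dec => answer (dec [])
  | w :: ws, dec => query w.1 w.2 fun z => ofList ws fun l => dec (z :: l)

theorem queries_ofList (M : Matrix (Fin n) (Fin n) ℂ) (ws : List ((Fin n → ℂ) × (Fin n → ℂ)))
    (dec : List ℂ → Bool) : (ofList ws dec).queries M = ws := by
  induction ws generalizing dec with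
  | nil => rfl
  | cons w ws ih => simp [ofList, queries, ih]

theorem output_ofList (M : Matrix (Fin n) (Fin n) ℂ) (ws : List ((Fin n → ℂ) × (Fin n → ℂ)))
    (dec : List ℂ → Bool) :
    (ofList ws dec).output M = dec (ws.map fun w => w.1 ⬝ᵥ M.mulVec w.2) := by
  induction ws generalizing dec with
  | nil => rfl
  | cons w ws ih => simp [ofList, output, ih]

end QueryTree

/-- The complex `0/1`-vector of a Boolean vector. -/
def boolVec {n : ℕ} (v : Fin n → Bool) : Fin n → ℂ := fun i => if v i then 1 else 0

theorem star_boolVec {n : ℕ} (v : Fin n → Bool) : star (boolVec v) = boolVec v := by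
  ext i
  by_cases h : v i <;> simp [boolVec, h]

theorem hasPrecision_boolVec {n B : ℕ} (hB : 1 ≤ B) (v : Fin n → Bool) :
    HasPrecision B (boolVec v) := by
  refine ⟨1, le_rfl, hB, fun i => ⟨if v i then 1 else 0, 0, ?_, by simp, ?_⟩⟩
  · split <;> simp [hB]
  · by_cases h : v i <;> simp [boolVec, h]

theorem hasPrecision_single {n B : ℕ} (hB : 1 ≤ B) (i : Fin n) :
    HasPrecision B (Pi.single i (1 : ℂ)) := by
  have h : Pi.single i (1 : ℂ) = boolVec fun j => decide (j = i) := by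
    ext j
    by_cases h : j = i
    · subst h; simp [boolVec]
    · simp [boolVec, h]
  rw [h]
  exact hasPrecision_boolVec hB _

/-- Flipping a bit `i` with `g i ≠ 0` changes the product by `± g i`, so it injects the zeros into
the nonzeros. -/
theorem card_boolVec_dotProduct_eq_zero_le {n : ℕ} (g : Fin n → ℂ) (hg : g ≠ 0) :
    2 * Fintype.card {v : Fin n → Bool // boolVec v ⬝ᵥ g = 0} ≤ 2 ^ n := by
  obtain ⟨i, hi⟩ := Function.ne_iff.mp hg
  have key : ∀ v : Fin n → Bool, boolVec v ⬝ᵥ g = 0 →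
      ¬ boolVec (Function.update v i (!v i)) ⬝ᵥ g = 0 := by
    intro v hv h
    have hd : ∀ j, (boolVec (Function.update v i (!v i)) j - boolVec v j) * g j =
        if j = i then (if v i then -1 else 1) * g i else 0 := by
      intro j
      by_cases hj : j = i
      · subst hj
        by_cases hvj : v j <;> simp [boolVec, hvj]
      · simp [boolVec, hj]
    have hsum : (boolVec (Function.update v i (!v i)) - boolVec v) ⬝ᵥ g =
        (if v i then -1 else 1) * g i := by
      simp only [dotProduct, Pi.sub_apply, hd]
      simp
    rw [sub_dotProduct, h, hv, sub_zero] at hsum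
    by_cases hvi : v i <;> simp_all
  have hle : Fintype.card {v : Fin n → Bool // boolVec v ⬝ᵥ g = 0} ≤
      Fintype.card {v : Fin n → Bool // ¬ boolVec v ⬝ᵥ g = 0} := by
    refine Fintype.card_le_of_injective
      (fun v => ⟨Function.update v.1 i (!v.1 i), key v.1 v.2⟩) fun v w hvw => ?_
    have h := congrArg Subtype.val hvw
    ext j
    have hj := congrFun h j
    by_cases hji : j = i
    · subst hji; simpa using hj
    · simpa [hji] using hj
  have hcompl := Fintype.card_subtype_compl fun v : Fin n → Bool => boolVec v ⬝ᵥ g = 0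
  have hsub := Fintype.card_subtype_le fun v : Fin n → Bool => boolVec v ⬝ᵥ g = 0
  simp only [Fintype.card_pi, Fintype.card_bool, Finset.prod_const, Finset.card_univ,
    Fintype.card_fin] at hcompl hsub
  omega

/-- A nonzero row of `H` is killed by at most half of the `v`; for the others `H v ≠ 0` is killed by
at most half of the `w`. Hence the fraction `1/2 + 1/2 * 1/2 = 3/4`. -/
theorem card_boolVec_bilinear_eq_zero_le {n : ℕ} (H : Matrix (Fin n) (Fin n) ℂ) (hH : H ≠ 0) :
    4 * Fintype.card {vw : (Fin n → Bool) × (Fin n → Bool) //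
      boolVec vw.2 ⬝ᵥ H.mulVec (boolVec vw.1) = 0} ≤ 3 * (2 ^ n * 2 ^ n) := by
  classical
  obtain ⟨i, hi⟩ : ∃ i, H i ≠ 0 := Function.ne_iff.mp hH
  have h1 := card_boolVec_dotProduct_eq_zero_le (H i) hi
  have hcard : Fintype.card {vw : (Fin n → Bool) × (Fin n → Bool) //
      boolVec vw.2 ⬝ᵥ H.mulVec (boolVec vw.1) = 0} =
      ∑ v : Fin n → Bool, Fintype.card {w : Fin n → Bool //
        boolVec w ⬝ᵥ H.mulVec (boolVec v) = 0} := by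
    simp only [Fintype.card_subtype, Finset.card_filter, Fintype.sum_prod_type]
  have hle : ∀ v : Fin n → Bool,
      2 * Fintype.card {w : Fin n → Bool // boolVec w ⬝ᵥ H.mulVec (boolVec v) = 0} ≤
      2 ^ n + if boolVec v ⬝ᵥ H i = 0 then 2 ^ n else 0 := by
    intro v
    split_ifs with hv
    · have := Fintype.card_subtype_le fun w : Fin n → Bool =>
        boolVec w ⬝ᵥ H.mulVec (boolVec v) = 0
      simp only [Fintype.card_pi, Fintype.card_bool, Finset.prod_const, Finset.card_univ,
        Fintype.card_fin] at this
      omega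
    · refine card_boolVec_dotProduct_eq_zero_le _ fun h => hv ?_
      have := congrFun h i
      rwa [mulVec, dotProduct_comm] at this
  have hs := Finset.sum_le_sum fun v (_ : v ∈ Finset.univ) => hle v
  rw [← Finset.mul_sum, ← hcard, Finset.sum_add_distrib, ← Finset.sum_filter,
    Finset.sum_const, Finset.sum_const, ← Fintype.card_subtype] at hs
  simp only [Finset.card_univ, Fintype.card_pi, Fintype.card_bool, Finset.prod_const,
    Fintype.card_fin, smul_eq_mul] at hs
  nlinarith [Nat.mul_le_mul_right (2 ^ n) h1]

/-- The list of queries that determine `M v` for all members `v` of a list. -/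
noncomputable def columnQueries {n : ℕ} (vs : List (Fin n → Bool)) :
    List ((Fin n → ℂ) × (Fin n → ℂ)) :=
  vs.flatMap fun v => (List.finRange n).map fun i => (Pi.single i 1, boolVec v)

theorem length_columnQueries {n : ℕ} (vs : List (Fin n → Bool)) :
    (columnQueries vs).length = vs.length * n := by
  simp [columnQueries, List.length_flatMap]

/-- One round of the unitarity test: `M` preserves the inner product of two `0/1`-vectors. -/
def PreservesInner {n : ℕ} (M : Matrix (Fin n) (Fin n) ℂ)
    (vw : (Fin n → Bool) × (Fin n → Bool)) : Prop :=
  star (M.mulVec (boolVec vw.2)) ⬝ᵥ M.mulVec (boolVec vw.1) = boolVec vw.2 ⬝ᵥ boolVec vw.1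

theorem preservesInner_iff {n : ℕ} (M : Matrix (Fin n) (Fin n) ℂ)
    (vw : (Fin n → Bool) × (Fin n → Bool)) :
    PreservesInner M vw ↔ boolVec vw.2 ⬝ᵥ (Mᴴ * M - 1).mulVec (boolVec vw.1) = 0 := by
  rw [PreservesInner, star_mulVec, star_boolVec, ← dotProduct_mulVec, mulVec_mulVec, sub_mulVec,
    one_mulVec, dotProduct_sub, sub_eq_zero]

theorem card_preservesInner_le {n : ℕ} (M : Matrix (Fin n) (Fin n) ℂ)
    (hM : M ∉ unitaryGroup (Fin n) ℂ) :
    4 * Nat.card {vw // PreservesInner M vw} ≤ 3 * (2 ^ n * 2 ^ n) := by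
  have hH : Mᴴ * M - 1 ≠ 0 := fun h => hM (mem_unitaryGroup_iff'.mpr (sub_eq_zero.mp h))
  simp only [preservesInner_iff]
  rw [Nat.card_eq_fintype_card]
  exact card_boolVec_bilinear_eq_zero_le _ hH

/-- The queries of the test with the pairs of vectors `s`. -/
noncomputable def testQueries {n T : ℕ} (s : Fin T → (Fin n → Bool) × (Fin n → Bool)) :
    List ((Fin n → ℂ) × (Fin n → ℂ)) :=
  columnQueries (List.ofFn (fun t => (s t).1) ++ List.ofFn fun t => (s t).2)

open Classical in
/-- The unitarity test as a query algorithm, for given pairs of vectors. -/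
noncomputable def testTree {n T : ℕ} (s : Fin T → (Fin n → Bool) × (Fin n → Bool)) :
    QueryTree n :=
  .ofList (testQueries s) fun l => decide (∃ M : Matrix (Fin n) (Fin n) ℂ,
    ((testQueries s).map fun w => w.1 ⬝ᵥ M.mulVec w.2) = l ∧ ∀ t, PreservesInner M (s t))

/-- The decision sees only the answers, so it asks for some matrix that fits them and passes. The
answers determine the images of all vectors in `s`, so every fitting matrix gets the same verdict as
`M`. -/
theorem output_testTree {n T : ℕ} (s : Fin T → (Fin n → Bool) × (Fin n → Bool))
    (M : Matrix (Fin n) (Fin n) ℂ) :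
    (testTree s).output M = true ↔ ∀ t, PreservesInner M (s t) := by
  simp only [testTree, QueryTree.output_ofList, decide_eq_true_eq]
  refine ⟨?_, fun h => ⟨M, rfl, h⟩⟩
  rintro ⟨M', hM', h⟩ t
  rw [List.map_inj_left] at hM'
  have hcol : ∀ v, v ∈ List.ofFn (fun t => (s t).1) ++ List.ofFn (fun t => (s t).2) →
      M'.mulVec (boolVec v) = M.mulVec (boolVec v) := by
    intro v hv
    ext i
    have := hM' (Pi.single i 1, boolVec v)
      (List.mem_flatMap.mpr ⟨v, hv, List.mem_map.mpr ⟨i, List.mem_finRange i, rfl⟩⟩)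
    simpa using this
  have ht := h t
  rwa [PreservesInner, hcol _ (by simp), hcol _ (by simp)] at ht

theorem exists_randomized_unitarity_test (p : ℝ) (hp' : p < 1) (c : ℕ) :
    ∃ C : ℕ, ∀ n : ℕ, 1 ≤ n → ∃ A : RandomizedQueryAlgorithm n,
      A.QueriesHavePrecision Set.univ (n ^ c) ∧
      A.MakesAtMost Set.univ (C * n) ∧
      A.DecidesUnitary Set.univ p := by
  classical
  -- `T` rounds all miss a nonunitary matrix with probability at most `(3/4) ^ T < 1 - p`; unitary
  -- ones are never rejected. Each round costs `2n` queries, hence `T + T`.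
  obtain ⟨T, hT⟩ := exists_pow_lt_of_lt_one (sub_pos.mpr hp') (by norm_num : (3 / 4 : ℝ) < 1)
  refine ⟨T + T, fun n hn => ?_⟩
  let _ : MeasurableSpace (Fin T → (Fin n → Bool) × (Fin n → Bool)) := ⊤
  have hmeas : ∀ U : Set (Fin T → (Fin n → Bool) × (Fin n → Bool)), MeasurableSet U :=
    fun _ => trivial
  let ν : PMF (Fin T → (Fin n → Bool) × (Fin n → Bool)) := PMF.uniformOfFintype _
  refine ⟨⟨Fin T → (Fin n → Bool) × (Fin n → Bool), ⊤, ν.toMeasure, inferInstance, testTree⟩,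
    ?_, ?_, ?_⟩
  · intro M _ s w hw
    change w ∈ (testTree s).queries M at hw
    rw [testTree, QueryTree.queries_ofList] at hw
    obtain ⟨v, -, hv⟩ := List.mem_flatMap.mp hw
    obtain ⟨i, -, rfl⟩ := List.mem_map.mp hv
    have hB : 1 ≤ n ^ c := Nat.one_le_pow _ _ hn
    exact ⟨hasPrecision_single hB i, hasPrecision_boolVec hB v⟩
  · intro M _ s
    change ((testTree s).queries M).length ≤ _
    rw [testTree, QueryTree.queries_ofList, testQueries, length_columnQueries]
    simp
  · intro M _
    refine ⟨trivial, ?_⟩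
    change p ≤ ν.toMeasure.real {s | (testTree s).output M = true ↔ M ∈ unitaryGroup (Fin n) ℂ}
    simp only [output_testTree]
    by_cases hM : M ∈ unitaryGroup (Fin n) ℂ
    · have hall : {s : Fin T → (Fin n → Bool) × (Fin n → Bool) |
          (∀ t, PreservesInner M (s t)) ↔ M ∈ unitaryGroup (Fin n) ℂ} = Set.univ := by
        refine Set.eq_univ_of_forall fun s => ⟨fun _ => hM, fun _ t => ?_⟩
        rw [preservesInner_iff, ← star_eq_conjTranspose, mem_unitaryGroup_iff'.mp hM]
        simp
      rw [hall, MeasureTheory.probReal_univ]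
      exact hp'.le
    · have hset : {s : Fin T → (Fin n → Bool) × (Fin n → Bool) |
          (∀ t, PreservesInner M (s t)) ↔ M ∈ unitaryGroup (Fin n) ℂ} =
          {s | ∀ t, PreservesInner M (s t)}ᶜ := by
        ext s
        simp [hM]
      have hcard : Fintype.card {s : Fin T → (Fin n → Bool) × (Fin n → Bool) |
          ∀ t, PreservesInner M (s t)} = Nat.card {vw // PreservesInner M vw} ^ T := by
        have e : {s : Fin T → (Fin n → Bool) × (Fin n → Bool) | ∀ t, PreservesInner M (s t)} ≃
            (Fin T → {vw // PreservesInner M vw}) :=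
          Equiv.subtypePiEquivPi (p := fun (_ : Fin T) vw => PreservesInner M vw)
        rw [← Nat.card_eq_fintype_card, Nat.card_congr e, Nat.card_pi]
        simp
      have hreal : ν.toMeasure.real {s | ∀ t, PreservesInner M (s t)} =
          (Nat.card {vw // PreservesInner M vw} / (2 ^ n * 2 ^ n) : ℝ) ^ T := by
        rw [MeasureTheory.measureReal_def, PMF.toMeasure_uniformOfFintype_apply _ (hmeas _), hcard]
        simp [div_pow]
      rw [hset, MeasureTheory.probReal_compl_eq_one_sub (hmeas _), hreal]
      have hle : (Nat.card {vw // PreservesInner M vw} / (2 ^ n * 2 ^ n) : ℝ) ≤ 3 / 4 := by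
        rw [div_le_div_iff₀ (by positivity) (by norm_num)]
        have := card_preservesInner_le M hM
        have h2 : ((4 * Nat.card {vw // PreservesInner M vw} : ℕ) : ℝ) ≤
          ((3 * (2 ^ n * 2 ^ n) : ℕ) : ℝ) := by exact_mod_cast this
        push_cast at h2
        linarith
      have := pow_le_pow_left₀ (by positivity) hle T
      linarith

/-! ### Boolean cube: level-one inequality, entropy and Hellinger distances -/

section Cube

variable {ι : Type*} [DecidableEq ι]

/-- The restriction of a Boolean vector to the set `D` of coordinates. -/
def bitMask {ι : Type*} (D a : ι → Bool) : ι → Bool := fun i => a i && D i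

theorem update_bitMask_update (D a : ι → Bool) (i : ι) (d e : Bool) :
    Function.update (bitMask (Function.update D i d) a) i e =
      Function.update (bitMask D a) i e := by
  ext j
  by_cases h : j = i
  · subst h; simp
  · simp [bitMask, h]

theorem bitMask_update (D a : ι → Bool) (i : ι) (e : Bool) (hi : D i = true) :
    bitMask D (Function.update a i e) = Function.update (bitMask D a) i e := by
  ext j
  by_cases h : j = i
  · subst h; simp [bitMask, hi]
  · simp [bitMask, h]

theorem update_bitMask_false (D a : ι → Bool) (i : ι) (hi : D i = false) :
    Function.update (bitMask D a) i false = bitMask D a := by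
  ext j
  by_cases h : j = i
  · subst h; simp [bitMask, hi]
  · simp [h]

variable [Fintype ι]

/-- The character of a bit. -/
def boolSign (e : Bool) : ℝ := if e then -1 else 1

/-- The exponential moment of independent signs factors into `cosh (l i) ≤ exp (l i ^ 2 / 2)`. -/
theorem sum_exp_boolSign_le (l : ι → ℝ) :
    ∑ a : ι → Bool, Real.exp (∑ i, l i * boolSign (a i)) ≤
      2 ^ Fintype.card ι * Real.exp ((∑ i, l i ^ 2) / 2) := by
  have h1 : ∑ a : ι → Bool, Real.exp (∑ i, l i * boolSign (a i)) =
      ∏ i, ∑ e : Bool, Real.exp (l i * boolSign e) := by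
    rw [Finset.prod_univ_sum, Fintype.piFinset_univ]
    simp only [Real.exp_sum]
  have h2 : (2 : ℝ) ^ Fintype.card ι * Real.exp ((∑ i, l i ^ 2) / 2) =
      ∏ i, 2 * Real.exp (l i ^ 2 / 2) := by
    rw [Finset.prod_mul_distrib, Finset.sum_div, Real.exp_sum]
    simp
  rw [h1, h2]
  refine Finset.prod_le_prod (fun i _ => Finset.sum_nonneg fun e _ => (Real.exp_pos _).le)
    fun i _ => ?_
  have := Real.cosh_le_exp_half_sq (l i)
  rw [Real.cosh_eq] at this
  simp only [Fintype.sum_bool, boolSign, if_true, Bool.false_eq_true, if_false, mul_neg, mul_one]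
  linarith

/-- The level-one inequality for subsets of the Boolean cube. -/
theorem sum_sq_sum_boolSign_le (A : Finset (ι → Bool)) (hA : A.Nonempty) :
    ∑ i, (∑ a ∈ A, boolSign (a i)) ^ 2 ≤
      2 * (A.card : ℝ) ^ 2 * Real.log (2 ^ Fintype.card ι / A.card) := by
  have hm : (0 : ℝ) < A.card := by exact_mod_cast hA.card_pos
  set m : ℝ := (A.card : ℝ) with hmdef
  -- `l` is the mean of `A`, so the functional `⟨l, ·⟩` has mean `|l|²` on `A`. Jensen gives `exp
  -- |l|² ≤ (2 ^ N / m) * exp (|l|² / 2)`, with `N` the dimension, and thus the bound on `|l|²`.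
  set l : ι → ℝ := fun i => (∑ a ∈ A, boolSign (a i)) / m with hl
  have hJ := convexOn_exp.map_sum_le (t := A) (w := fun _ => 1 / m)
    (p := fun a => ∑ i, l i * boolSign (a i)) (fun _ _ => by positivity)
    (by rw [Finset.sum_const, nsmul_eq_mul, ← hmdef]; field_simp) (fun _ _ => Set.mem_univ _)
  simp only [smul_eq_mul, ← Finset.mul_sum] at hJ
  have hexp : 1 / m * ∑ a ∈ A, ∑ i, l i * boolSign (a i) = ∑ i, l i ^ 2 := by
    rw [Finset.sum_comm, Finset.mul_sum]
    refine Finset.sum_congr rfl fun i _ => ?_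
    rw [← Finset.mul_sum]
    simp only [hl]
    ring
  rw [hexp] at hJ
  have hsub : ∑ a ∈ A, Real.exp (∑ i, l i * boolSign (a i)) ≤
      ∑ a : ι → Bool, Real.exp (∑ i, l i * boolSign (a i)) :=
    Finset.sum_le_sum_of_subset_of_nonneg (Finset.subset_univ _) fun _ _ _ => (Real.exp_pos _).le
  have hall := hsub.trans (sum_exp_boolSign_le l)
  have h3 : Real.exp ((∑ i, l i ^ 2) / 2) ≤ 2 ^ Fintype.card ι / m := by
    rw [le_div_iff₀ hm]
    have hE := Real.exp_pos ((∑ i, l i ^ 2) / 2)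
    have hsq : Real.exp (∑ i, l i ^ 2) =
        Real.exp ((∑ i, l i ^ 2) / 2) * Real.exp ((∑ i, l i ^ 2) / 2) := by
      rw [← Real.exp_add]; ring_nf
    rw [hsq, one_div, ← div_eq_inv_mul, le_div_iff₀ hm] at hJ
    refine le_of_mul_le_mul_left ?_ hE
    linarith
  have h4 := Real.log_le_log (Real.exp_pos _) h3
  rw [Real.log_exp] at h4
  have h5 : ∑ i, (∑ a ∈ A, boolSign (a i)) ^ 2 = m ^ 2 * ∑ i, l i ^ 2 := by
    rw [Finset.mul_sum]
    refine Finset.sum_congr rfl fun i _ => ?_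
    simp only [hl]
    field_simp
  rw [h5]
  nlinarith [mul_le_mul_of_nonneg_left h4 (sq_nonneg m)]

theorem sum_update_bool (F : (ι → Bool) → ℝ) (i : ι) (e : Bool) :
    ∑ a, F (Function.update a i e) = 2 * ∑ a, if a i = e then F a else 0 := by
  have hflip : ∑ a : ι → Bool, (if a i = !e then F (Function.update a i e) else 0) =
      ∑ a, if a i = e then F a else 0 := by
    have hinv : Function.Involutive fun a : ι → Bool => Function.update a i (!a i) := by
      intro a; simp
    refine Fintype.sum_bijective _ hinv.bijective _ _ fun a => ?_
    by_cases h : a i = !e <;> simp [h]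
  have hsplit : ∀ a : ι → Bool, F (Function.update a i e) =
      (if a i = e then F a else 0) + if a i = !e then F (Function.update a i e) else 0 := by
    intro a
    by_cases h : a i = e
    · have : Function.update a i e = a := by rw [← h, Function.update_eq_self]
      cases e <;> simp [h, this]
    · have : a i = !e := by cases e <;> simp_all
      simp [this]
  rw [Finset.sum_congr rfl fun a _ => hsplit a, Finset.sum_add_distrib, hflip, two_mul]

open Classical in
/-- The probability of `f` at the image of a random vector under `h`. -/
noncomputable def cubeProb (f : (ι → Bool) → Prop) (h : (ι → Bool) → ι → Bool) : ℝ :=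
  (∑ a : ι → Bool, if f (h a) then 1 else 0) / 2 ^ Fintype.card ι

/-- The probability of `f` at a random vector that is masked by `D`. -/
noncomputable def maskProb (f : (ι → Bool) → Prop) (D : ι → Bool) : ℝ :=
  cubeProb f (bitMask D)

/-- The probability of `f` at a random vector that is masked by `D` and has the bit `e` at `i`. -/
noncomputable def pinProb (f : (ι → Bool) → Prop) (D : ι → Bool) (i : ι) (e : Bool) : ℝ :=
  cubeProb f fun a => Function.update (bitMask D a) i e

theorem maskProb_nonneg (f : (ι → Bool) → Prop) (D : ι → Bool) : 0 ≤ maskProb f D :=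
  div_nonneg (Finset.sum_nonneg fun a _ => by split <;> norm_num) (by positivity)

theorem pinProb_nonneg (f : (ι → Bool) → Prop) (D : ι → Bool) (i : ι) (e : Bool) :
    0 ≤ pinProb f D i e :=
  div_nonneg (Finset.sum_nonneg fun a _ => by split <;> norm_num) (by positivity)

theorem maskProb_le_one (f : (ι → Bool) → Prop) (D : ι → Bool) : maskProb f D ≤ 1 := by
  classical
  rw [maskProb, cubeProb, div_le_one (by positivity)]
  calc _ ≤ ∑ a : ι → Bool, (1 : ℝ) := Finset.sum_le_sum fun a _ => by split <;> norm_num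
    _ = 2 ^ Fintype.card ι := by simp

/-- Pinning overrides the mask at `i`. This allows `D i` to be chosen freely when averaging over
`D`. -/
theorem pinProb_update (f : (ι → Bool) → Prop) (D : ι → Bool) (i : ι) (d e : Bool) :
    pinProb f (Function.update D i d) i e = pinProb f D i e := by
  refine congrArg (· / _) (Finset.sum_congr rfl fun a _ => ?_)
  beta_reduce
  rw [update_bitMask_update]

theorem pinProb_false (f : (ι → Bool) → Prop) (D : ι → Bool) (i : ι) (hi : D i = false) :
    pinProb f D i false = maskProb f D := by
  refine congrArg (· / _) (Finset.sum_congr rfl fun a _ => ?_)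
  beta_reduce
  rw [update_bitMask_false D a i hi]

open Classical in
theorem pinProb_eq (f : (ι → Bool) → Prop) (D : ι → Bool) (i : ι) (e : Bool)
    (hi : D i = true) : pinProb f D i e = 2 * (∑ a ∈ Finset.univ.filter
      (fun a : ι → Bool => f (bitMask D a)), if a i = e then 1 else 0) /
        2 ^ Fintype.card ι := by
  rw [pinProb, cubeProb]
  simp only [← bitMask_update D _ i e hi]
  rw [sum_update_bool (fun a => if f (bitMask D a) then (1 : ℝ) else 0), Finset.sum_filter]
  congr 2
  refine Finset.sum_congr rfl fun a _ => ?_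
  split_ifs <;> rfl

/-- For unmasked `i` the two pinned probabilities have sum `2 * maskProb f D`, and their difference
is the bias of bit `i` on the event. The level-one inequality applies through `(√x - √y)² * (x + y)
≤ (x - y)²`. -/
theorem sum_sq_sqrt_pinProb_sub_le (f : (ι → Bool) → Prop) (D : ι → Bool) :
    ∑ i, (if D i then (√(pinProb f D i true) - √(pinProb f D i false)) ^ 2 else 0) ≤
      4 * maskProb f D * Real.log (maskProb f D)⁻¹ := by
  classical
  set A : Finset (ι → Bool) := Finset.univ.filter fun a => f (bitMask D a) with hAdef
  set c : ℝ := 2 ^ Fintype.card ι with hc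
  have hcpos : 0 < c := by positivity
  have hA : maskProb f D = A.card / c := by
    rw [maskProb, cubeProb, hAdef, Finset.card_filter]
    push_cast
    rfl
  have hadd : ∀ i, D i = true → pinProb f D i false + pinProb f D i true = 2 * maskProb f D := by
    intro i hi
    rw [pinProb_eq f D i _ hi, pinProb_eq f D i _ hi, hA, ← add_div, ← mul_add,
      ← Finset.sum_add_distrib, mul_div_assoc]
    congr 2
    rw [Finset.card_eq_sum_ones]
    push_cast
    refine Finset.sum_congr rfl fun a _ => ?_
    cases a i <;> simp
  have hsub : ∀ i, D i = true → pinProb f D i false - pinProb f D i true =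
      2 * (∑ a ∈ A, boolSign (a i)) / c := by
    intro i hi
    rw [pinProb_eq f D i _ hi, pinProb_eq f D i _ hi, ← sub_div, ← mul_sub,
      ← Finset.sum_sub_distrib]
    congr 2
    refine Finset.sum_congr rfl fun a _ => ?_
    cases a i <;> simp [boolSign]
  rcases A.eq_empty_or_nonempty with h0 | hne
  · have hz : maskProb f D = 0 := by rw [hA, h0]; simp
    rw [hz]
    simp only [mul_zero, zero_mul]
    refine Finset.sum_nonpos fun i _ => ?_
    split_ifs with hi
    · have h1 := hadd i hi
      have h2 := hsub i hi
      rw [h0] at h2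
      simp only [Finset.sum_empty, mul_zero, zero_div] at h2
      rw [sub_eq_zero.mp h2]
      simp
    · exact le_rfl
  · have hm : (0 : ℝ) < A.card := by exact_mod_cast hne.card_pos
    have hpos : 0 < maskProb f D := by rw [hA]; positivity
    have hterm : ∀ i, maskProb f D *
        (if D i then (√(pinProb f D i true) - √(pinProb f D i false)) ^ 2 else 0) ≤
        2 / c ^ 2 * (∑ a ∈ A, boolSign (a i)) ^ 2 := by
      intro i
      split_ifs with hi
      · have h1 := hadd i hi
        have h2 := hsub i hi
        have hs1 := Real.sq_sqrt (pinProb_nonneg f D i true)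
        have hs0 := Real.sq_sqrt (pinProb_nonneg f D i false)
        set s := √(pinProb f D i true)
        set t := √(pinProb f D i false)
        have hs : 0 ≤ s := Real.sqrt_nonneg _
        have ht : 0 ≤ t := Real.sqrt_nonneg _
        have h3 : (s - t) ^ 2 * (s ^ 2 + t ^ 2) ≤ (t ^ 2 - s ^ 2) ^ 2 := by
          have : (t ^ 2 - s ^ 2) ^ 2 = (s - t) ^ 2 * (s ^ 2 + t ^ 2) +
            (s - t) ^ 2 * (2 * (s * t)) := by ring
          rw [this]
          have : 0 ≤ (s - t) ^ 2 * (2 * (s * t)) := by positivity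
          linarith
        rw [hs1, hs0, h2, add_comm, h1] at h3
        have h4 : (2 * (∑ a ∈ A, boolSign (a i)) / c) ^ 2 =
            2 * (2 / c ^ 2 * (∑ a ∈ A, boolSign (a i)) ^ 2) := by
          field_simp
        rw [h4] at h3
        linarith
      · rw [mul_zero]; positivity
    have hsum := Finset.sum_le_sum fun i (_ : i ∈ Finset.univ) => hterm i
    rw [← Finset.mul_sum, ← Finset.mul_sum] at hsum
    have hl1 := mul_le_mul_of_nonneg_left (sum_sq_sum_boolSign_le A hne)
      (show 0 ≤ 2 / c ^ 2 by positivity)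
    refine le_of_mul_le_mul_left (hsum.trans (hl1.trans (le_of_eq ?_))) hpos
    rw [hA, inv_div]
    field_simp
    ring

/-- Entropy is at most the logarithm of the support size: apply `log z ≤ z - 1` with `z = 1 / (s τ *
|S|)`. -/
theorem sum_mul_log_inv_le {T : Type*} (S : Finset T) (s : T → ℝ) (hs : ∀ τ ∈ S, 0 ≤ s τ)
    (hsum : ∑ τ ∈ S, s τ = 1) : ∑ τ ∈ S, s τ * Real.log (s τ)⁻¹ ≤ Real.log S.card := by
  have hne : S.Nonempty := by
    rw [Finset.nonempty_iff_ne_empty]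
    rintro rfl
    simp at hsum
  have hN : (0 : ℝ) < S.card := by exact_mod_cast hne.card_pos
  have hterm : ∀ τ ∈ S, s τ * Real.log (s τ)⁻¹ ≤
      s τ * Real.log S.card + ((S.card : ℝ)⁻¹ - s τ) := by
    intro τ hτ
    rcases (hs τ hτ).eq_or_lt with h | h
    · rw [← h]; simp
    · have h1 := Real.log_le_sub_one_of_pos (show 0 < (s τ)⁻¹ * (S.card : ℝ)⁻¹ by positivity)
      rw [Real.log_mul (by positivity) (by positivity), Real.log_inv (S.card : ℝ)] at h1
      have h2 := mul_le_mul_of_nonneg_left h1 h.le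
      have h3 : s τ * ((s τ)⁻¹ * (S.card : ℝ)⁻¹ - 1) = (S.card : ℝ)⁻¹ - s τ := by
        field_simp
      rw [h3] at h2
      linarith
  refine (Finset.sum_le_sum hterm).trans (le_of_eq ?_)
  rw [Finset.sum_add_distrib, Finset.sum_sub_distrib, ← Finset.sum_mul, hsum, Finset.sum_const,
    nsmul_eq_mul, mul_inv_cancel₀ hN.ne']
  ring

/-- In a partition into rectangles, one random side carries little information on its bits. -/
theorem sum_hellinger_le {T : Type*} (S : Finset T) (f g : T → (ι → Bool) → Prop)
    (D E : ι → Bool) (hsum : ∑ τ ∈ S, maskProb (f τ) D * maskProb (g τ) E = 1) :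
    ∑ i, (if D i then ∑ τ ∈ S, maskProb (g τ) E *
      (√(pinProb (f τ) D i true) - √(pinProb (f τ) D i false)) ^ 2 else 0) ≤
      4 * Real.log S.card := by
  have h1 : ∑ i, (if D i then ∑ τ ∈ S, maskProb (g τ) E *
      (√(pinProb (f τ) D i true) - √(pinProb (f τ) D i false)) ^ 2 else 0) =
      ∑ τ ∈ S, maskProb (g τ) E * ∑ i, (if D i then
        (√(pinProb (f τ) D i true) - √(pinProb (f τ) D i false)) ^ 2 else 0) := by
    simp only [Finset.mul_sum]
    rw [Finset.sum_comm]
    refine Finset.sum_congr rfl fun i _ => ?_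
    split_ifs <;> simp
  have h2 := sum_mul_log_inv_le S _ (fun τ _ => mul_nonneg (maskProb_nonneg (f τ) D)
    (maskProb_nonneg (g τ) E)) hsum
  rw [h1]
  refine le_trans ?_ (mul_le_mul_of_nonneg_left h2 (by norm_num : (0 : ℝ) ≤ 4))
  rw [Finset.mul_sum]
  refine Finset.sum_le_sum fun τ _ => ?_
  refine (mul_le_mul_of_nonneg_left (sum_sq_sqrt_pinProb_sub_le (f τ) D)
    (maskProb_nonneg (g τ) E)).trans ?_
  have hf := maskProb_nonneg (f τ) D
  have hg := maskProb_nonneg (g τ) E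
  have hg1 := maskProb_le_one (g τ) E
  rcases hf.eq_or_lt with h | hf
  · rw [← h]; simp
  rcases hg.eq_or_lt with h | hg
  · rw [← h]; simp
  -- Passing from one side's probability to that of the whole rectangle turns the sum into the
  -- entropy of the transcript.
  have hlog : Real.log (maskProb (f τ) D)⁻¹ ≤
      Real.log (maskProb (f τ) D * maskProb (g τ) E)⁻¹ := by
    refine Real.log_le_log (by positivity) (inv_anti₀ (by positivity) ?_)
    exact mul_le_of_le_one_right hf.le hg1
  calc maskProb (g τ) E * (4 * maskProb (f τ) D * Real.log (maskProb (f τ) D)⁻¹)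
      = 4 * (maskProb (f τ) D * maskProb (g τ) E * Real.log (maskProb (f τ) D)⁻¹) := by ring
    _ ≤ _ := by gcongr

end Cube

/-! ### Cut-and-paste and the disjointness lower bound -/

/-- The cut-and-paste bound for distributions of product form. -/
theorem sq_sum_sub_le_of_product {T : Type*} (S S' : Finset T) (hS : S' ⊆ S)
    (α β : Bool → T → ℝ) (hα : ∀ e τ, 0 ≤ α e τ) (hβ : ∀ e τ, 0 ≤ β e τ)
    (hsum : ∀ e e', ∑ τ ∈ S, α e τ * β e' τ = 1) :
    (∑ τ ∈ S', (α false τ * β false τ - α true τ * β true τ)) ^ 2 ≤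
      8 * (∑ τ ∈ S, β false τ * (√(α true τ) - √(α false τ)) ^ 2 +
        ∑ τ ∈ S, α false τ * (√(β true τ) - √(β false τ)) ^ 2) := by
  obtain ⟨r, hr⟩ : ∃ r : Bool → T → ℝ, r = fun e τ => √(α e τ) := ⟨_, rfl⟩
  obtain ⟨t, ht⟩ : ∃ t : Bool → T → ℝ, t = fun e τ => √(β e τ) := ⟨_, rfl⟩
  have hα2 : ∀ e τ, α e τ = r e τ ^ 2 := fun e τ => by rw [hr, Real.sq_sqrt (hα e τ)]
  have hβ2 : ∀ e τ, β e τ = t e τ ^ 2 := fun e τ => by rw [ht, Real.sq_sqrt (hβ e τ)]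
  have hr0 : ∀ e τ, 0 ≤ r e τ := fun e τ => by rw [hr]; exact Real.sqrt_nonneg _
  have ht0 : ∀ e τ, 0 ≤ t e τ := fun e τ => by rw [ht]; exact Real.sqrt_nonneg _
  have hr' : ∀ e τ, √(α e τ) = r e τ := fun e τ => by rw [hr]
  have ht' : ∀ e τ, √(β e τ) = t e τ := fun e τ => by rw [ht]
  simp only [hr', ht']
  simp only [hα2, hβ2] at hsum ⊢
  have habs : |∑ τ ∈ S', (r false τ ^ 2 * t false τ ^ 2 - r true τ ^ 2 * t true τ ^ 2)| ≤
      ∑ τ ∈ S, |r false τ * t false τ - r true τ * t true τ| *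
        (r false τ * t false τ + r true τ * t true τ) := by
    refine (Finset.abs_sum_le_sum_abs _ _).trans ?_
    refine (Finset.sum_le_sum_of_subset_of_nonneg hS fun _ _ _ => abs_nonneg _).trans
      (le_of_eq (Finset.sum_congr rfl fun τ _ => ?_))
    have hnn : 0 ≤ r false τ * t false τ + r true τ * t true τ :=
      add_nonneg (mul_nonneg (hr0 _ _) (ht0 _ _)) (mul_nonneg (hr0 _ _) (ht0 _ _))
    conv_rhs => rw [← abs_of_nonneg hnn, ← abs_mul]
    congr 1
    ring
  have hcs := Finset.sum_mul_sq_le_sq_mul_sq S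
    (fun τ => |r false τ * t false τ - r true τ * t true τ|)
    (fun τ => r false τ * t false τ + r true τ * t true τ)
  have hplus : ∑ τ ∈ S, (r false τ * t false τ + r true τ * t true τ) ^ 2 ≤ 4 := by
    have : ∑ τ ∈ S, (r false τ * t false τ + r true τ * t true τ) ^ 2 ≤
        ∑ τ ∈ S, (2 * (r false τ ^ 2 * t false τ ^ 2) + 2 * (r true τ ^ 2 * t true τ ^ 2)) :=
      Finset.sum_le_sum fun τ _ => by
        nlinarith [sq_nonneg (r false τ * t false τ - r true τ * t true τ)]
    rw [Finset.sum_add_distrib, ← Finset.mul_sum, ← Finset.mul_sum, hsum, hsum] at this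
    linarith
  -- Both sides equal `2 - 2 * ∑ r₀ r₁ t₀ t₁`: the product form makes the cross terms agree.
  have hcut : ∑ τ ∈ S, |r false τ * t false τ - r true τ * t true τ| ^ 2 =
      ∑ τ ∈ S, (r false τ * t true τ - r true τ * t false τ) ^ 2 := by
    have h : ∑ τ ∈ S, (|r false τ * t false τ - r true τ * t true τ| ^ 2 -
        (r false τ * t true τ - r true τ * t false τ) ^ 2) =
        ∑ τ ∈ S, (r false τ ^ 2 * t false τ ^ 2 + r true τ ^ 2 * t true τ ^ 2 -
          r false τ ^ 2 * t true τ ^ 2 - r true τ ^ 2 * t false τ ^ 2) :=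
      Finset.sum_congr rfl fun τ _ => by rw [sq_abs]; ring
    rw [Finset.sum_sub_distrib, Finset.sum_sub_distrib, Finset.sum_sub_distrib,
      Finset.sum_add_distrib, hsum, hsum, hsum, hsum] at h
    linarith
  -- Go from `(0,1)` to `(1,0)` through `(0,0)`, changing one bit at a time.
  have htri : ∑ τ ∈ S, (r false τ * t true τ - r true τ * t false τ) ^ 2 ≤
      2 * (∑ τ ∈ S, t false τ ^ 2 * (r true τ - r false τ) ^ 2 +
        ∑ τ ∈ S, r false τ ^ 2 * (t true τ - t false τ) ^ 2) := by
    rw [← Finset.sum_add_distrib, Finset.mul_sum]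
    refine Finset.sum_le_sum fun τ _ => ?_
    nlinarith [sq_nonneg (t false τ * (r true τ - r false τ) +
      r false τ * (t true τ - t false τ))]
  have hsq := sq_le_sq' (neg_le_of_abs_le habs) (le_of_abs_le habs)
  have hnn : 0 ≤ ∑ τ ∈ S, |r false τ * t false τ - r true τ * t true τ| ^ 2 :=
    Finset.sum_nonneg fun _ _ => sq_nonneg _
  have hmul := mul_le_mul_of_nonneg_left hplus hnn
  rw [hcut] at hcs hmul
  linarith

section Disjointness

variable {ι T : Type*} [Fintype ι] [DecidableEq ι]

theorem cubeProb_mul_cubeProb (f g : (ι → Bool) → Prop) (h k : (ι → Bool) → ι → Bool)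
    (P : (ι → Bool) → (ι → Bool) → Prop) [∀ x y, Decidable (P x y)]
    (hP : ∀ x y, P x y ↔ f x ∧ g y) :
    cubeProb f h * cubeProb g k =
      (∑ a : ι → Bool, ∑ b : ι → Bool, if P (h a) (k b) then (1 : ℝ) else 0) /
        4 ^ Fintype.card ι := by
  classical
  rw [cubeProb, cubeProb, div_mul_div_comm, ← mul_pow, Finset.sum_mul_sum]
  norm_num only
  congr 1
  refine Finset.sum_congr rfl fun a _ => Finset.sum_congr rfl fun b _ => ?_
  simp only [hP]
  by_cases h1 : f (h a) <;> by_cases h2 : g (k b) <;> simp [h1, h2]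

theorem sum_cubeProb_mul_cubeProb [DecidableEq T] (Φ : (ι → Bool) → (ι → Bool) → T)
    (f g : T → (ι → Bool) → Prop) (hΦ : ∀ x y τ, Φ x y = τ ↔ f τ x ∧ g τ y) (S : Finset T)
    (hS : ∀ x y, Φ x y ∈ S) (acc : T → Bool) (h k : (ι → Bool) → ι → Bool) :
    ∑ τ ∈ S with acc τ, cubeProb (f τ) h * cubeProb (g τ) k =
      (∑ a : ι → Bool, ∑ b : ι → Bool, if acc (Φ (h a) (k b)) then (1 : ℝ) else 0) /
        4 ^ Fintype.card ι := by
  simp only [fun τ => cubeProb_mul_cubeProb (f τ) (g τ) h k (fun x y => Φ x y = τ)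
    fun x y => hΦ x y τ]
  rw [← Finset.sum_div, Finset.sum_comm]
  congr 1
  refine Finset.sum_congr rfl fun a _ => ?_
  rw [Finset.sum_comm]
  refine Finset.sum_congr rfl fun b _ => ?_
  rw [Finset.sum_ite_eq]
  simp [hS]

theorem sum_cubeProb_mul_cubeProb_eq_one [DecidableEq T] (Φ : (ι → Bool) → (ι → Bool) → T)
    (f g : T → (ι → Bool) → Prop) (hΦ : ∀ x y τ, Φ x y = τ ↔ f τ x ∧ g τ y) (S : Finset T)
    (hS : ∀ x y, Φ x y ∈ S) (h k : (ι → Bool) → ι → Bool) :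
    ∑ τ ∈ S, cubeProb (f τ) h * cubeProb (g τ) k = 1 := by
  have := sum_cubeProb_mul_cubeProb Φ f g hΦ S hS (fun _ => true) h k
  rw [Finset.filter_true_of_mem fun _ _ => rfl] at this
  rw [this, div_eq_one_iff_eq (by positivity)]
  simp [← mul_pow]
  norm_num

/-- The summand does not depend on `D i`, so it may be averaged over `D i = true` alone, at the cost
of a factor `2`. Then the other side is masked at `i`, its bit is already `false`, and
`sum_hellinger_le` applies for each `D`. -/
theorem sum_sum_hellinger_le (S : Finset T) (f g : T → (ι → Bool) → Prop)
    (hsum : ∀ D E, ∑ τ ∈ S, maskProb (f τ) D * maskProb (g τ) E = 1) :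
    ∑ i, ∑ D : ι → Bool, ∑ τ ∈ S, pinProb (g τ) (fun j => !D j) i false *
      (√(pinProb (f τ) D i true) - √(pinProb (f τ) D i false)) ^ 2 ≤
      8 * 2 ^ Fintype.card ι * Real.log S.card := by
  have hnot : ∀ (D : ι → Bool) i d,
      (fun j => !(Function.update D i d) j) = Function.update (fun j => !D j) i (!d) := by
    intro D i d
    ext j
    by_cases h : j = i
    · subst h; simp
    · simp [h]
  have h1 : ∀ i, ∑ D : ι → Bool, ∑ τ ∈ S, pinProb (g τ) (fun j => !D j) i false *
      (√(pinProb (f τ) D i true) - √(pinProb (f τ) D i false)) ^ 2 =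
      2 * ∑ D : ι → Bool, if D i then ∑ τ ∈ S, maskProb (g τ) (fun j => !D j) *
        (√(pinProb (f τ) D i true) - √(pinProb (f τ) D i false)) ^ 2 else 0 := by
    intro i
    have h := sum_update_bool (fun D : ι → Bool => ∑ τ ∈ S, pinProb (g τ) (fun j => !D j) i false *
      (√(pinProb (f τ) D i true) - √(pinProb (f τ) D i false)) ^ 2) i true
    simp only [hnot, pinProb_update] at h
    rw [h]
    congr 1
    refine Finset.sum_congr rfl fun D _ => ?_
    split_ifs with hD
    · refine Finset.sum_congr rfl fun τ _ => ?_
      rw [pinProb_false (g τ) (fun j => !D j) i (by simp [hD])]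
    · rfl
  rw [Finset.sum_congr rfl fun i _ => h1 i, ← Finset.mul_sum, Finset.sum_comm]
  have h2 := Finset.sum_le_sum fun (D : ι → Bool) (_ : D ∈ Finset.univ) =>
    sum_hellinger_le S f g D (fun j => !D j) (hsum D _)
  rw [Finset.sum_const, nsmul_eq_mul] at h2
  simp only [Finset.card_univ, Fintype.card_pi, Fintype.card_bool, Finset.prod_const,
    Nat.cast_pow, Nat.cast_ofNat] at h2
  linarith

/-- The randomized communication lower bound for disjointness: a rectangular partition with few
parts does not distinguish disjoint masked pairs from those that meet at one coordinate. -/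
theorem sq_sum_disjointness_le [DecidableEq T] (Φ : (ι → Bool) → (ι → Bool) → T)
    (f g : T → (ι → Bool) → Prop) (hΦ : ∀ x y τ, Φ x y = τ ↔ f τ x ∧ g τ y) (S : Finset T)
    (hS : ∀ x y, Φ x y ∈ S) (acc : T → Bool) :
    (∑ i : ι, ∑ D : ι → Bool, ∑ a : ι → Bool, ∑ b : ι → Bool,
      ((if acc (Φ (Function.update (bitMask D a) i false)
        (Function.update (bitMask (fun j => !D j) b) i false)) then (1 : ℝ) else 0) -
      if acc (Φ (Function.update (bitMask D a) i true)
        (Function.update (bitMask (fun j => !D j) b) i true)) then (1 : ℝ) else 0)) ^ 2 ≤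
      128 * Fintype.card ι * (8 ^ Fintype.card ι) ^ 2 * Real.log S.card := by
  set c : ℝ := 4 ^ Fintype.card ι with hc
  have hcpos : 0 < c := by positivity
  set Q : ι → (ι → Bool) → Bool → ℝ := fun i D e => ∑ τ ∈ S with acc τ,
    pinProb (f τ) D i e * pinProb (g τ) (fun j => !D j) i e with hQ
  have hsum1 : ∀ i (D : ι → Bool) e e',
      ∑ τ ∈ S, pinProb (f τ) D i e * pinProb (g τ) (fun j => !D j) i e' = 1 :=
    fun i D e e' => sum_cubeProb_mul_cubeProb_eq_one Φ f g hΦ S hS _ _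
  set HA : ι → (ι → Bool) → ℝ := fun i D => ∑ τ ∈ S, pinProb (g τ) (fun j => !D j) i false *
    (√(pinProb (f τ) D i true) - √(pinProb (f τ) D i false)) ^ 2 with hHA
  set HB : ι → (ι → Bool) → ℝ := fun i D => ∑ τ ∈ S, pinProb (f τ) D i false *
    (√(pinProb (g τ) (fun j => !D j) i true) -
      √(pinProb (g τ) (fun j => !D j) i false)) ^ 2 with hHB
  have hadv : ∀ i D, (Q i D false - Q i D true) ^ 2 ≤ 8 * (HA i D + HB i D) := by
    intro i D
    simp only [hQ]
    rw [← Finset.sum_sub_distrib]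
    exact sq_sum_sub_le_of_product S _ (Finset.filter_subset _ _)
      (fun e τ => pinProb (f τ) D i e) (fun e τ => pinProb (g τ) (fun j => !D j) i e)
      (fun e τ => pinProb_nonneg _ _ _ _) (fun e τ => pinProb_nonneg _ _ _ _) (hsum1 i D)
  have hA : ∑ i, ∑ D, HA i D ≤ 8 * 2 ^ Fintype.card ι * Real.log S.card :=
    sum_sum_hellinger_le S f g fun D E => sum_cubeProb_mul_cubeProb_eq_one Φ f g hΦ S hS _ _
  -- The players are exchanged and `D` is replaced by its complement.
  have hB : ∑ i, ∑ D, HB i D ≤ 8 * 2 ^ Fintype.card ι * Real.log S.card := by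
    refine le_trans (le_of_eq ?_) (sum_sum_hellinger_le S g f fun D E => ?_)
    · refine Finset.sum_congr rfl fun i _ => ?_
      have hinv : Function.Involutive fun (D : ι → Bool) j => !D j := fun D => by simp
      refine Fintype.sum_bijective _ hinv.bijective _ _ fun D => ?_
      simp [hHB]
    · simp only [mul_comm (maskProb (g _) D)]
      exact sum_cubeProb_mul_cubeProb_eq_one Φ f g hΦ S hS _ _
  have hQsum : ∑ i : ι, ∑ D : ι → Bool, ∑ a : ι → Bool, ∑ b : ι → Bool,
      ((if acc (Φ (Function.update (bitMask D a) i false)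
        (Function.update (bitMask (fun j => !D j) b) i false)) then (1 : ℝ) else 0) -
      if acc (Φ (Function.update (bitMask D a) i true)
        (Function.update (bitMask (fun j => !D j) b) i true)) then (1 : ℝ) else 0) =
      c * ∑ k : ι × (ι → Bool), (Q k.1 k.2 false - Q k.1 k.2 true) := by
    rw [Finset.mul_sum, Fintype.sum_prod_type]
    refine Finset.sum_congr rfl fun i _ => Finset.sum_congr rfl fun D _ => ?_
    have h := fun e => sum_cubeProb_mul_cubeProb Φ f g hΦ S hS acc
      (fun a => Function.update (bitMask D a) i e)
      (fun b => Function.update (bitMask (fun j => !D j) b) i e)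
    simp only [hQ, pinProb]
    rw [h, h, ← hc]
    simp only [Finset.sum_sub_distrib]
    field_simp
  -- Cauchy–Schwarz over the pairs `(i, D)`. Below, `128 = 8 * (8 + 8)`: cut-and-paste times the two
  -- Hellinger sums.
  have hcs := sq_sum_le_card_mul_sum_sq (s := (Finset.univ : Finset (ι × (ι → Bool))))
    (f := fun k => Q k.1 k.2 false - Q k.1 k.2 true)
  have htot : ∑ k : ι × (ι → Bool), (Q k.1 k.2 false - Q k.1 k.2 true) ^ 2 ≤
      128 * 2 ^ Fintype.card ι * Real.log S.card := by
    refine (Finset.sum_le_sum fun k _ => hadv k.1 k.2).trans ?_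
    rw [← Finset.mul_sum, Finset.sum_add_distrib, Fintype.sum_prod_type, Fintype.sum_prod_type]
    linarith
  simp only [Finset.card_univ, Fintype.card_prod, Fintype.card_pi, Fintype.card_bool,
    Finset.prod_const, Nat.cast_mul, Nat.cast_pow, Nat.cast_ofNat] at hcs
  rw [hQsum, mul_pow]
  have h8 : (8 : ℝ) ^ Fintype.card ι = c * 2 ^ Fintype.card ι := by
    rw [hc, ← mul_pow]; norm_num
  rw [h8]
  calc c ^ 2 * (∑ k : ι × (ι → Bool), (Q k.1 k.2 false - Q k.1 k.2 true)) ^ 2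
      ≤ c ^ 2 * (Fintype.card ι * 2 ^ Fintype.card ι *
          (128 * 2 ^ Fintype.card ι * Real.log S.card)) := by
        refine mul_le_mul_of_nonneg_left (hcs.trans ?_) (by positivity)
        exact mul_le_mul_of_nonneg_left htot (by positivity)
    _ = _ := by ring

end Disjointness

/-! ### Query algorithms as communication protocols -/

namespace QueryTree

variable {n : ℕ}

/-- The pairs of partial answers on the sum of two matrices. -/
def transcript (X Y : Matrix (Fin n) (Fin n) ℂ) : QueryTree n → List (ℂ × ℂ)
  | answer _ => []
  | query u v next => (u ⬝ᵥ X.mulVec v, u ⬝ᵥ Y.mulVec v) ::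
      (next (u ⬝ᵥ X.mulVec v + u ⬝ᵥ Y.mulVec v)).transcript X Y

/-- The answer of the algorithm along a list of pairs of partial answers. -/
def outputAlong : QueryTree n → List (ℂ × ℂ) → Bool
  | answer b, _ => b
  -- Never reached along an actual transcript.
  | query _ _ _, [] => false
  | query _ _ next, m :: τ => (next (m.1 + m.2)).outputAlong τ

/-- The partial answers of the matrix `X`, selected by `π`, are those in the list. -/
def Consistent (π : ℂ × ℂ → ℂ) (X : Matrix (Fin n) (Fin n) ℂ) :
    QueryTree n → List (ℂ × ℂ) → Prop
  | answer _, τ => τ = []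
  | query _ _ _, [] => False
  | query u v next, m :: τ => π m = u ⬝ᵥ X.mulVec v ∧ (next (m.1 + m.2)).Consistent π X τ

/-- The rectangle property: `τ` itself fixes the path through the tree, so each matrix can be
checked against it separately. -/
theorem transcript_eq_iff (X Y : Matrix (Fin n) (Fin n) ℂ) (t : QueryTree n)
    (τ : List (ℂ × ℂ)) :
    t.transcript X Y = τ ↔ t.Consistent Prod.fst X τ ∧ t.Consistent Prod.snd Y τ := by
  induction t generalizing τ with
  | answer b => simp [transcript, Consistent, eq_comm]
  | query u v next ih =>
    cases τ with
    | nil => simp [transcript, Consistent]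
    | cons m τ =>
      obtain ⟨m₁, m₂⟩ := m
      simp only [transcript, Consistent, List.cons.injEq, Prod.mk.injEq]
      constructor
      · rintro ⟨⟨rfl, rfl⟩, h⟩
        have := (ih _ _).mp h
        exact ⟨⟨rfl, this.1⟩, rfl, this.2⟩
      · rintro ⟨⟨rfl, h1⟩, rfl, h2⟩
        exact ⟨⟨rfl, rfl⟩, (ih _ _).mpr ⟨h1, h2⟩⟩

theorem output_add (X Y : Matrix (Fin n) (Fin n) ℂ) (t : QueryTree n) :
    t.output (X + Y) = t.outputAlong (t.transcript X Y) := by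
  induction t with
  | answer b => rfl
  | query u v next ih =>
    simp only [output, outputAlong, transcript, add_mulVec, dotProduct_add]
    exact ih _

open Classical in
theorem card_image_transcript_le {κ : Type*} (X Y : κ → Matrix (Fin n) (Fin n) ℂ) (N : ℕ)
    (hN : 1 ≤ N) (good : (Fin n → ℂ) × (Fin n → ℂ) → Prop)
    (hgood : ∀ w, good w → ∃ V : Finset (ℂ × ℂ), V.card ≤ N ∧
      ∀ k, (w.1 ⬝ᵥ (X k).mulVec w.2, w.1 ⬝ᵥ (Y k).mulVec w.2) ∈ V)
    (t : QueryTree n) (q : ℕ) (I : Finset κ)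
    (hq : ∀ k ∈ I, (t.queries (X k + Y k)).length ≤ q)
    (hI : ∀ k ∈ I, ∀ w ∈ t.queries (X k + Y k), good w) :
    (I.image fun k => t.transcript (X k) (Y k)).card ≤ N ^ q := by
  induction t generalizing q I with
  | answer b =>
    refine le_trans (Finset.card_le_card (t := {[]}) ?_) (Nat.one_le_pow _ _ hN)
    intro τ hτ
    obtain ⟨k, -, rfl⟩ := Finset.mem_image.mp hτ
    simp [transcript]
  | query u v next ih =>
    rcases I.eq_empty_or_nonempty with rfl | ⟨k₀, hk₀⟩
    · simp
    obtain ⟨q, rfl⟩ : ∃ r, q = r + 1 := by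
      have := hq k₀ hk₀
      simp only [queries, List.length_cons] at this
      exact ⟨q - 1, by omega⟩
    obtain ⟨V, hV, hmem⟩ := hgood (u, v) (hI k₀ hk₀ _ (by simp [queries]))
    -- Inputs with the same first pair of values continue in the same subtree, and there are at most
    -- `N` such pairs.
    set J : ℂ × ℂ → Finset κ := fun m => I.filter fun k =>
      (u ⬝ᵥ (X k).mulVec v, u ⬝ᵥ (Y k).mulVec v) = m with hJ
    have hsub : (I.image fun k => (query u v next).transcript (X k) (Y k)) ⊆
        V.biUnion fun m => ((J m).image fun k =>
          (next (m.1 + m.2)).transcript (X k) (Y k)).image (List.cons m) := by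
      intro τ hτ
      obtain ⟨k, hk, rfl⟩ := Finset.mem_image.mp hτ
      refine Finset.mem_biUnion.mpr ⟨_, hmem k, Finset.mem_image.mpr ⟨_,
        Finset.mem_image_of_mem _ (Finset.mem_filter.mpr ⟨hk, rfl⟩), rfl⟩⟩
    refine (Finset.card_le_card hsub).trans (Finset.card_biUnion_le.trans ?_)
    have hpart : ∀ m ∈ V, (((J m).image fun k =>
        (next (m.1 + m.2)).transcript (X k) (Y k)).image (List.cons m)).card ≤ N ^ q := by
      intro m _
      refine Finset.card_image_le.trans (ih _ q (J m) ?_ ?_)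
      · intro k hk
        obtain ⟨hkI, rfl⟩ := Finset.mem_filter.mp hk
        have := hq k hkI
        simpa [queries, add_mulVec, dotProduct_add] using this
      · intro k hk w hw
        obtain ⟨hkI, rfl⟩ := Finset.mem_filter.mp hk
        refine hI k hkI w ?_
        simp only [queries, add_mulVec, dotProduct_add]
        exact List.mem_cons_of_mem _ hw
    refine (Finset.sum_le_card_nsmul _ _ _ hpart).trans ?_
    rw [smul_eq_mul, pow_succ, mul_comm]
    exact Nat.mul_le_mul_left _ hV

end QueryTree

/-! ### Reduction from disjointness to unitarity -/

/-- The possible values of a query of precision `B` on diagonal matrices with small Gaussian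
integers as entries. -/
theorem exists_finset_dotProduct_diagonal {n B : ℕ} {u v : Fin n → ℂ} (hu : HasPrecision B u)
    (hv : HasPrecision B v) : ∃ V : Finset ℂ, V.card ≤ (8 * n * B ^ 2 + 1) ^ 2 ∧
      ∀ w : Fin n → ℂ, (∀ i, ∃ k l : ℤ, |k| + |l| ≤ 2 ∧ w i = k + l * Complex.I) →
        u ⬝ᵥ (diagonal w).mulVec v ∈ V := by
  classical
  obtain ⟨d, -, -, hu⟩ := hu
  obtain ⟨d', -, -, hv⟩ := hv
  choose a b ha hb hu using hu
  choose a' b' ha' hb' hv using hv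
  -- Numerators of `u i * v i` have parts at most `2 * B ^ 2`; an entry with `|k| + |l| ≤ 2` doubles
  -- this, and there are `n` summands. The denominator `d * d'` is fixed by the query.
  set R : Finset ℤ := Finset.Icc (-(4 * n * B ^ 2 : ℕ)) (4 * n * B ^ 2 : ℕ) with hR
  have hRcard : R.card = 8 * n * B ^ 2 + 1 := by
    rw [hR, Int.card_Icc]
    have h : 8 * n * B ^ 2 = 2 * (4 * n * B ^ 2) := by ring
    omega
  refine ⟨(R ×ˢ R).image fun rs => ((rs.1 : ℂ) + rs.2 * Complex.I) / (d * d'), ?_, ?_⟩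
  · refine Finset.card_image_le.trans ?_
    rw [Finset.card_product, hRcard, sq (8 * n * B ^ 2 + 1)]
  · intro w hw
    choose k l hkl hw using hw
    have hprod : ∀ x y x' y' : ℤ, |x| ≤ B → |y| ≤ B → |x'| ≤ B → |y'| ≤ B →
        |x * x' - y * y'| ≤ 2 * B ^ 2 ∧ |x * y' + y * x'| ≤ 2 * B ^ 2 := by
      intro x y x' y' hx hy hx' hy'
      have hm : ∀ s t : ℤ, |s| ≤ B → |t| ≤ B → |s * t| ≤ B ^ 2 := by
        intro s t hs ht
        rw [abs_mul, sq]
        exact mul_le_mul hs ht (abs_nonneg _) (by positivity)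
      have h1 := abs_le.mp (hm x x' hx hx')
      have h2 := abs_le.mp (hm y y' hy hy')
      have h3 := abs_le.mp (hm x y' hx hy')
      have h4 := abs_le.mp (hm y x' hy hx')
      constructor <;> rw [abs_le] <;> constructor <;> linarith
    have hcomb : ∀ s t k l : ℤ, |s| ≤ 2 * B ^ 2 → |t| ≤ 2 * B ^ 2 → |k| + |l| ≤ 2 →
        |s * k| + |t * l| ≤ 4 * B ^ 2 := by
      intro s t k l hs ht hkl
      rw [abs_mul, abs_mul]
      nlinarith [mul_le_mul_of_nonneg_right hs (abs_nonneg k),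
        mul_le_mul_of_nonneg_right ht (abs_nonneg l), sq_nonneg (B : ℤ)]
    have hsumR : ∀ F : Fin n → ℤ, (∀ i, |F i| ≤ 4 * B ^ 2) → ∑ i, F i ∈ R := by
      intro F hF
      rw [hR, Finset.mem_Icc, ← abs_le]
      refine (Finset.abs_sum_le_sum_abs _ _).trans
        ((Finset.sum_le_card_nsmul _ _ _ fun i _ => hF i).trans (le_of_eq ?_))
      simp
      ring
    refine Finset.mem_image.mpr ⟨
      (∑ i, ((a i * a' i - b i * b' i) * k i - (a i * b' i + b i * a' i) * l i),
        ∑ i, ((a i * a' i - b i * b' i) * l i + (a i * b' i + b i * a' i) * k i)),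
      Finset.mk_mem_product (hsumR _ fun i => ?_) (hsumR _ fun i => ?_), ?_⟩
    · obtain ⟨h1, h2⟩ := hprod _ _ _ _ (ha i) (hb i) (ha' i) (hb' i)
      exact (abs_sub _ _).trans (hcomb _ _ _ _ h1 h2 (hkl i))
    · obtain ⟨h1, h2⟩ := hprod _ _ _ _ (ha i) (hb i) (ha' i) (hb' i)
      exact (abs_add_le _ _).trans (hcomb _ _ _ _ h1 h2 (by rw [add_comm]; exact hkl i))
    · simp only [dotProduct, mulVec_diagonal, hu, hv, hw]
      push_cast
      rw [Finset.sum_mul, ← Finset.sum_add_distrib, Finset.sum_div]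
      refine Finset.sum_congr rfl fun i _ => ?_
      linear_combination -((b i * b' i * (k i + l i * Complex.I) +
        (a i * b' i + b i * a' i) * l i) / (d * d') : ℂ) * Complex.I_sq

/-- The contribution of the first vector to the diagonal. -/
noncomputable def firstDiagonal {n : ℕ} (x : Fin n → Bool) : Fin n → ℂ :=
  fun i => if x i then Complex.I else 1

/-- The contribution of the second vector to the diagonal. -/
noncomputable def secondDiagonal {n : ℕ} (y : Fin n → Bool) : Fin n → ℂ :=
  fun i => if y i then -2 else 0

/-- A diagonal matrix that is unitary iff the two vectors are disjoint. -/
noncomputable def disjointnessMatrix {n : ℕ} (x y : Fin n → Bool) : Matrix (Fin n) (Fin n) ℂ :=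
  diagonal (firstDiagonal x) + diagonal (secondDiagonal y)

/-- The possible diagonal entries are `1`, `i`, `-1` and `i - 2`; only the last, where the vectors
meet, is off the unit circle. -/
theorem disjointnessMatrix_mem_unitaryGroup_iff {n : ℕ} (x y : Fin n → Bool) :
    disjointnessMatrix x y ∈ unitaryGroup (Fin n) ℂ ↔ ∀ i, ¬ (x i = true ∧ y i = true) := by
  rw [mem_unitaryGroup_iff, disjointnessMatrix, diagonal_add, star_eq_conjTranspose,
    diagonal_conjTranspose, diagonal_mul_diagonal, ← diagonal_one, diagonal_eq_diagonal_iff]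
  refine forall_congr' fun i => ?_
  cases hx : x i <;> cases hy : y i <;>
    simp [firstDiagonal, secondDiagonal, hx, hy, Complex.ext_iff] <;> norm_num

theorem disjointnessMatrix_mem_preciseMatrices {n B : ℕ} (hB : 2 ≤ B) (x y : Fin n → Bool) :
    disjointnessMatrix x y ∈ preciseMatrices n B := by
  refine ⟨1, le_rfl, by omega, fun ij => ?_⟩
  have hB' : (2 : ℤ) ≤ B := by exact_mod_cast hB
  by_cases h : ij.1 = ij.2
  · refine ⟨(if x ij.1 then 0 else 1) + (if y ij.1 then -2 else 0), if x ij.1 then 1 else 0,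
      ?_, ?_, ?_⟩
    · rw [abs_le]; split_ifs <;> constructor <;> linarith
    · rw [abs_le]; split_ifs <;> constructor <;> linarith
    · have hentry : disjointnessMatrix x y ij.1 ij.2 =
          firstDiagonal x ij.1 + secondDiagonal y ij.1 := by
        rw [disjointnessMatrix, diagonal_add, ← h, diagonal_apply_eq]
      change disjointnessMatrix x y ij.1 ij.2 = _
      rw [hentry]
      cases hx : x ij.1 <;> cases hy : y ij.1 <;>
        simp [firstDiagonal, secondDiagonal, hx, hy] <;> ring
  · exact ⟨0, 0, by simp, by simp, by simp [disjointnessMatrix, diagonal_apply_ne _ h]⟩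

/-- A randomized algorithm that decides unitarity has a deterministic instance with advantage. -/
theorem RandomizedQueryAlgorithm.exists_advantage {n : ℕ} {A : RandomizedQueryAlgorithm n}
    {S : Set (Matrix (Fin n) (Fin n) ℂ)} {p : ℝ} (hA : A.DecidesUnitary S p) {κ : Type*}
    [Fintype κ] (M N : κ → Matrix (Fin n) (Fin n) ℂ)
    (hM : ∀ k, M k ∈ S ∧ M k ∈ unitaryGroup (Fin n) ℂ)
    (hN : ∀ k, N k ∈ S ∧ N k ∉ unitaryGroup (Fin n) ℂ) :
    ∃ ω, (2 * p - 1) * Fintype.card κ ≤ ∑ k, ((if (A.tree ω).output (M k) then (1 : ℝ) else 0) -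
      if (A.tree ω).output (N k) then (1 : ℝ) else 0) := by
  have hind : ∀ L ∈ S, MeasureTheory.Integrable
      (fun ω => if (A.tree ω).output L then (1 : ℝ) else 0) A.μ ∧
      ∫ ω, (if (A.tree ω).output L then (1 : ℝ) else 0) ∂A.μ =
        A.μ.real {ω | (A.tree ω).output L = true} := by
    intro L hL
    have hmeas := (hA L hL).1
    have heq : (fun ω => if (A.tree ω).output L then (1 : ℝ) else 0) =
        {ω | (A.tree ω).output L = true}.indicator fun _ => 1 := by
      ext ω
      simp [Set.indicator_apply]
    rw [heq]
    refine ⟨(MeasureTheory.integrable_const 1).indicator hmeas, ?_⟩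
    rw [MeasureTheory.integral_indicator hmeas]
    simp
  have hMp : ∀ k, p ≤ A.μ.real {ω | (A.tree ω).output (M k) = true} := by
    intro k
    have := (hA _ (hM k).1).2
    simpa [(hM k).2] using this
  have hNp : ∀ k, A.μ.real {ω | (A.tree ω).output (N k) = true} ≤ 1 - p := by
    intro k
    have := (hA _ (hN k).1).2
    have hset : {ω | (A.tree ω).output (N k) = true ↔ N k ∈ unitaryGroup (Fin n) ℂ} =
        {ω | (A.tree ω).output (N k) = true}ᶜ := by
      ext ω
      simp [(hN k).2]
    rw [hset, MeasureTheory.probReal_compl_eq_one_sub (hA _ (hN k).1).1] at this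
    linarith
  have hint : ∀ k, MeasureTheory.Integrable (fun ω =>
      (if (A.tree ω).output (M k) then (1 : ℝ) else 0) -
        if (A.tree ω).output (N k) then (1 : ℝ) else 0) A.μ :=
    fun k => (hind _ (hM k).1).1.sub (hind _ (hN k).1).1
  -- Some outcome does at least as well as the mean, which is at least `2p - 1` for each `k`.
  obtain ⟨ω, hω⟩ := MeasureTheory.exists_integral_le
    (MeasureTheory.integrable_finsetSum Finset.univ fun k _ => hint k)
  refine ⟨ω, le_trans ?_ hω⟩
  rw [MeasureTheory.integral_finsetSum _ fun k _ => hint k]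
  have hk : ∀ k ∈ Finset.univ, 2 * p - 1 ≤ ∫ ω,
      ((if (A.tree ω).output (M k) then (1 : ℝ) else 0) -
        if (A.tree ω).output (N k) then (1 : ℝ) else 0) ∂A.μ := by
    intro k _
    rw [MeasureTheory.integral_sub (hind _ (hM k).1).1 (hind _ (hN k).1).1,
      (hind _ (hM k).1).2, (hind _ (hN k).1).2]
    linarith [hMp k, hNp k]
  have := Finset.card_nsmul_le_sum _ _ _ hk
  rwa [nsmul_eq_mul, Finset.card_univ, mul_comm] at this

/-- Two values per query, one for each summand. The bound uses `8 * z + 1 ≤ 16 * z ≤ n ^ 4 * z` for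
`z ≥ 1`. -/
theorem card_query_values_le {n : ℕ} (hn : 2 ≤ n) (c : ℕ) :
    (8 * n * (n ^ c) ^ 2 + 1) ^ 2 * (8 * n * (n ^ c) ^ 2 + 1) ^ 2 ≤ n ^ (4 * (2 * c + 5)) := by
  have h1 : 8 * n * (n ^ c) ^ 2 + 1 ≤ n ^ (2 * c + 5) := by
    have hpos : 1 ≤ n * (n ^ c) ^ 2 := Nat.one_le_iff_ne_zero.mpr (by positivity)
    have h4 : 2 ^ 4 ≤ n ^ 4 := Nat.pow_le_pow_left hn 4
    calc 8 * n * (n ^ c) ^ 2 + 1 ≤ 2 ^ 4 * (n * (n ^ c) ^ 2) := by linarith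
      _ ≤ n ^ 4 * (n * (n ^ c) ^ 2) := Nat.mul_le_mul_right _ h4
      _ = n ^ (2 * c + 5) := by ring
  calc _ = (8 * n * (n ^ c) ^ 2 + 1) ^ 4 := by ring
    _ ≤ (n ^ (2 * c + 5)) ^ 4 := Nat.pow_le_pow_left h1 4
    _ = _ := by rw [← pow_mul, mul_comm]

theorem le_queries_of_decidesUnitary {p : ℝ} (hp : 1 / 2 < p) {b c n q : ℕ} (hb : 1 ≤ b)
    (hn : 2 ≤ n) {A : RandomizedQueryAlgorithm n}
    (hprec : A.QueriesHavePrecision (preciseMatrices n (n ^ b)) (n ^ c))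
    (hq : A.MakesAtMost (preciseMatrices n (n ^ b)) q)
    (hA : A.DecidesUnitary (preciseMatrices n (n ^ b)) p) :
    (2 * p - 1) ^ 2 * n ≤ 128 * (4 * (2 * c + 5)) * (q * Real.log n) := by
  classical
  have hB : 2 ≤ n ^ b := hn.trans (Nat.le_self_pow (by omega) n)
  have hmem := fun x y : Fin n → Bool => disjointnessMatrix_mem_preciseMatrices hB x y
  let κ := Fin n × (Fin n → Bool) × (Fin n → Bool) × (Fin n → Bool)
  -- The complementary masks make the pair disjoint off `k.1`, so the pinned bit `e` alone decides
  -- unitarity.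
  let L : Bool → κ → Matrix (Fin n) (Fin n) ℂ := fun e k => disjointnessMatrix
    (Function.update (bitMask k.2.1 k.2.2.1) k.1 e)
    (Function.update (bitMask (fun j => !k.2.1 j) k.2.2.2) k.1 e)
  obtain ⟨ω, hω⟩ := RandomizedQueryAlgorithm.exists_advantage hA (L false) (L true)
    (fun k => ⟨hmem _ _, (disjointnessMatrix_mem_unitaryGroup_iff _ _).mpr fun i => by
      by_cases h : i = k.1
      · subst h; simp
      · cases hD : k.2.1 i <;> simp [h, bitMask, hD]⟩)
    (fun k => ⟨hmem _ _, fun h =>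
      (disjointnessMatrix_mem_unitaryGroup_iff _ _).mp h k.1 (by simp)⟩)
  set t := A.tree ω with ht
  set Φ : (Fin n → Bool) → (Fin n → Bool) → List (ℂ × ℂ) := fun x y =>
    t.transcript (diagonal (firstDiagonal x)) (diagonal (secondDiagonal y)) with hΦ
  set S : Finset (List (ℂ × ℂ)) := (Finset.univ : Finset ((Fin n → Bool) × (Fin n → Bool))).image
    fun k => Φ k.1 k.2 with hS
  have hN := card_query_values_le hn c
  have hcard : S.card ≤ (n ^ (4 * (2 * c + 5))) ^ q := by
    refine QueryTree.card_image_transcript_le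
      (fun k : (Fin n → Bool) × (Fin n → Bool) => diagonal (firstDiagonal k.1))
      (fun k => diagonal (secondDiagonal k.2)) _ (Nat.one_le_pow _ _ (by omega))
      (fun w => HasPrecision (n ^ c) w.1 ∧ HasPrecision (n ^ c) w.2) ?_ t q _
      (fun k _ => hq _ (hmem k.1 k.2) ω) (fun k _ => hprec _ (hmem k.1 k.2) ω)
    rintro ⟨u, v⟩ ⟨hu, hv⟩
    obtain ⟨V, hV, hval⟩ := exists_finset_dotProduct_diagonal hu hv
    refine ⟨V ×ˢ V, ?_, fun k => Finset.mk_mem_product (hval _ fun i => ?_) (hval _ fun i => ?_)⟩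
    · rw [Finset.card_product]
      exact (Nat.mul_le_mul hV hV).trans hN
    · cases h : k.1 i
      · exact ⟨1, 0, by norm_num, by simp [firstDiagonal, h]⟩
      · exact ⟨0, 1, by norm_num, by simp [firstDiagonal, h]⟩
    · cases h : k.2 i
      · exact ⟨0, 0, by norm_num, by simp [secondDiagonal, h]⟩
      · exact ⟨-2, 0, by norm_num, by simp [secondDiagonal, h]⟩
  have hdisj := sq_sum_disjointness_le Φ
    (fun τ x => t.Consistent Prod.fst (diagonal (firstDiagonal x)) τ)
    (fun τ y => t.Consistent Prod.snd (diagonal (secondDiagonal y)) τ)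
    (fun x y τ => QueryTree.transcript_eq_iff _ _ t τ) S
    (fun x y => Finset.mem_image_of_mem (fun k : (Fin n → Bool) × (Fin n → Bool) => Φ k.1 k.2)
      (Finset.mem_univ (x, y))) t.outputAlong
  simp only [hΦ, ← QueryTree.output_add] at hdisj
  simp only [κ, L, disjointnessMatrix, Fintype.sum_prod_type] at hω
  have hSpos : (0 : ℝ) < S.card := by
    exact_mod_cast Finset.card_pos.mpr (Finset.univ_nonempty.image _)
  have hlog : Real.log S.card ≤ 4 * (2 * c + 5) * (q * Real.log n) := by
    have h := Real.log_le_log hSpos (show (S.card : ℝ) ≤ ((n : ℝ) ^ (4 * (2 * c + 5))) ^ q by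
      exact_mod_cast hcard)
    rw [Real.log_pow, Real.log_pow] at h
    push_cast at h
    linarith
  have hκ : ((Fintype.card κ : ℕ) : ℝ) = n * 8 ^ n := by
    simp only [κ, Fintype.card_prod, Fintype.card_pi, Fintype.card_bool, Fintype.card_fin,
      Finset.prod_const, Finset.card_univ]
    push_cast
    rw [← mul_pow, ← mul_pow]
    norm_num
  have hnpos : (0 : ℝ) < n := by exact_mod_cast (by omega : 0 < n)
  -- Here `p > 1/2` enters: the advantage is nonnegative and can be squared.
  have hnonneg : 0 ≤ (2 * p - 1) * (Fintype.card κ : ℝ) :=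
    mul_nonneg (by linarith) (Nat.cast_nonneg _)
  have hfin := (pow_le_pow_left₀ hnonneg hω 2).trans hdisj
  rw [hκ, Fintype.card_fin] at hfin
  have h8 : (0 : ℝ) < n * (8 ^ n) ^ 2 := by positivity
  have hmain : (2 * p - 1) ^ 2 * n ≤ 128 * Real.log S.card := by
    refine le_of_mul_le_mul_left ?_ h8
    linarith
  linarith

theorem mainTheorem2 (p : ℝ) (hp : 1 / 2 < p) (hp' : p < 1)
    (b c : ℕ) (hb : 1 ≤ b) (hc : 1 ≤ c) :
    (∃ K : ℝ, 0 < K ∧ ∀ n : ℕ, 2 ≤ n → ∀ (q : ℕ) (A : RandomizedQueryAlgorithm n),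
      A.QueriesHavePrecision (preciseMatrices n (n ^ b)) (n ^ c) →
      A.MakesAtMost (preciseMatrices n (n ^ b)) q →
      A.DecidesUnitary (preciseMatrices n (n ^ b)) p →
      K * (n / Real.log n) ≤ q) ∧
    (∃ C : ℕ, ∀ n : ℕ, 1 ≤ n → ∃ A : RandomizedQueryAlgorithm n,
      A.QueriesHavePrecision Set.univ (n ^ c) ∧
      A.MakesAtMost Set.univ (C * n) ∧
      A.DecidesUnitary Set.univ p) := by
  refine ⟨⟨(2 * p - 1) ^ 2 / (128 * (4 * (2 * c + 5))), ?_, ?_⟩,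
    exists_randomized_unitarity_test p hp' c⟩
  · have : 0 < 2 * p - 1 := by linarith
    positivity
  · intro n hn q A hprec hq hA
    have hlog : 0 < Real.log n := Real.log_pos (by exact_mod_cast (by omega : 1 < n))
    rw [div_mul_div_comm, div_le_iff₀ (by positivity)]
    have := le_queries_of_decidesUnitary hp hb hn hprec hq hA
    linarith
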